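/- Let $R=(a_1,b_1)\times(a_2,b_2)\subset\mathbb R^2$ be a bounded rectangle ($a_1<b_1$, $a_2<b_2$) and let $L^2_0(R)=\{f\in L^2(R):\int_R f\,dx=0\}$. For every $r\in L^2_0(R)$ there is a unique (up to equality almost everywhere on $R$) weak solution $\phi\in H^1(R)$ with $\int_R\phi\,dx=0$ of the Neumann problem $-\Delta\phi=r$ in $R$, $\nabla\phi\cdot\mathbf n=0$ on $\partial R$, that is, $\int_R\nabla\phi\cdot\nabla v\,dx=\int_R r\,v\,dx$ for all $v\in H^1(R)$; and the Poisson energy $E=\frac12\int_R r\,\phi\,dx$ satisfies $E\ge 0$, and $\int_R r^2\,dx=0$ if and only if $E=0$. In particular, consider a floorplan: modules $i=1,\dots,n$ with measurable shapes of finite area (for instance rectangles), placed at $c=(c_1,\dots,c_n)\in(\mathbb R^2)^n$, so that module $i$ occupies the translate $M_i$ of its shape by $c_i$. Let $\rho(x;c)=\sum_{i=1}^n \mathbf 1_{M_i}(x)$, $\bar\rho=\frac1{|R|}\sum_{i=1}^n|M_i|$ and $r(x;c)=\rho(x;c)-\bar\rho$, and suppose that $r(\cdot;c)\in L^2_0(R)$.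 Let $E(c)=\frac12\int_R r(x;c)\,\phi(x)\,dx$, where $\phi$ is the solution above for $r=r(\cdot;c)$, and let $\mathrm{Var}(\rho)=\int_R(\rho(x;c)-\bar\rho)^2\,dx$. Then \[ E(c)\ge 0,\qquad\text{and}\qquad \mathrm{Var}(\rho)=0\iff E(c)=0 . \] -/

import Mathlib

open MeasureTheory Set
open scoped ContDiff

noncomputable section

namespace PoissonFloorplan

/-- The open rectangle `(a₁, b₁) × (a₂, b₂)` in the plane. -/
def rectangle (a₁ b₁ a₂ b₂ : ℝ) : Set (ℝ × ℝ) := Ioo a₁ b₁ ×ˢ Ioo a₂ b₂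

/-- `L²₀(R)`: square-integrable functions on `R` with zero integral. -/
def MemL2Zero (R : Set (ℝ × ℝ)) (f : ℝ × ℝ → ℝ) : Prop :=
  MemLp f 2 (volume.restrict R) ∧ ∫ x in R, f x = 0

/-- Test functions: `C_c^∞(R)`. -/
structure IsTestFunction (R : Set (ℝ × ℝ)) (η : ℝ × ℝ → ℝ) : Prop where
  smooth : ContDiff ℝ ∞ η
  compactSupport : HasCompactSupport η
  support_subset : tsupport η ⊆ R

/-- `g` is the weak derivative of `u` on `R` in the direction `e`. -/
def HasWeakDeriv (R : Set (ℝ × ℝ)) (e : ℝ × ℝ) (u g : ℝ × ℝ → ℝ) : Prop :=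
  ∀ η, IsTestFunction R η →
    ∫ x in R, u x * fderiv ℝ η x e = -∫ x in R, g x * η x

/-- `u ∈ H¹(R)` with weak gradient `(g₁, g₂)`. -/
structure HasH1Gradient (R : Set (ℝ × ℝ)) (u g₁ g₂ : ℝ × ℝ → ℝ) : Prop where
  memLp : MemLp u 2 (volume.restrict R)
  memLp_fst : MemLp g₁ 2 (volume.restrict R)
  memLp_snd : MemLp g₂ 2 (volume.restrict R)
  deriv_fst : HasWeakDeriv R (1, 0) u g₁
  deriv_snd : HasWeakDeriv R (0, 1) u g₂

/-- `φ` is a zero-mean weak solution in `H¹(R)` of `-Δφ = r` in `R`, `∇φ · n = 0` on `∂R`: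
`∫_R ∇φ · ∇v = ∫_R r v` for all `v ∈ H¹(R)`. -/
def IsNeumannPotential (R : Set (ℝ × ℝ)) (r φ : ℝ × ℝ → ℝ) : Prop :=
  ∫ x in R, φ x = 0 ∧
  ∃ g₁ g₂, HasH1Gradient R φ g₁ g₂ ∧
    ∀ v h₁ h₂, HasH1Gradient R v h₁ h₂ →
      ∫ x in R, (g₁ x * h₁ x + g₂ x * h₂ x) = ∫ x in R, r x * v x

/-- The potential `φ = G r`, `G = (-Δ_N)⁻¹`: a representative of the zero-mean weak solution. -/
def neumannPotential (R : Set (ℝ × ℝ)) (r : ℝ × ℝ → ℝ) : ℝ × ℝ → ℝ :=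
  Classical.epsilon (IsNeumannPotential R r)

/-- The Poisson energy `½ ∫_R r φ` of a residual density `r`. -/
def poissonEnergy (R : Set (ℝ × ℝ)) (r : ℝ × ℝ → ℝ) : ℝ :=
  (1 / 2) * ∫ x in R, r x * neumannPotential R r x

/-- The region occupied by a module of shape `K` (given relative to its center) placed at `p`. -/
def moduleRegion (K : Set (ℝ × ℝ)) (p : ℝ × ℝ) : Set (ℝ × ℝ) := {x | x - p ∈ K}

/-- The aggregate density `ρ(·; c)`: the sum of the indicators of the placed modules. -/
def density {n : ℕ} (K : Fin n → Set (ℝ × ℝ)) (c : Fin n → ℝ × ℝ) (x : ℝ × ℝ) : ℝ :=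
  ∑ i, (moduleRegion (K i) (c i)).indicator (fun _ => (1 : ℝ)) x

/-- The average density `ρ̄ = |R|⁻¹ ∑ᵢ Aᵢ`. -/
def averageDensity (R : Set (ℝ × ℝ)) {n : ℕ} (K : Fin n → Set (ℝ × ℝ))
    (c : Fin n → ℝ × ℝ) : ℝ :=
  (∑ i, volume.real (moduleRegion (K i) (c i))) / volume.real R

/-- The residual density `r(·; c) = ρ(·; c) - ρ̄`. -/
def residual (R : Set (ℝ × ℝ)) {n : ℕ} (K : Fin n → Set (ℝ × ℝ))
    (c : Fin n → ℝ × ℝ) (x : ℝ × ℝ) : ℝ :=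
  density K c x - averageDensity R K c

/-- `Var(ρ) = ∫_R (ρ(x; c) - ρ̄)² dx`. -/
def densityVariance (R : Set (ℝ × ℝ)) {n : ℕ} (K : Fin n → Set (ℝ × ℝ))
    (c : Fin n → ℝ × ℝ) : ℝ :=
  ∫ x in R, (density K c x - averageDensity R K c) ^ 2

/-- `E(c)`: the Poisson energy of a floorplan. -/
def floorplanEnergy (R : Set (ℝ × ℝ)) {n : ℕ} (K : Fin n → Set (ℝ × ℝ))
    (c : Fin n → ℝ × ℝ) : ℝ :=
  poissonEnergy R (residual R K c)

end PoissonFloorplan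

end

namespace PoissonFloorplan

/-! ### Antiderivatives of test functions along one coordinate. -/

section

/-! Everything rests on the Poincaré inequality for zero-mean `u` on the rectangle, proved here by
duality. Fix a test function `θ` of integral one. Every test function `f` satisfies `f - (∫ f) θ =
∂₁ w₁ + ∂₂ w₂` with test functions `w₁, w₂` whose `L²` norms are controlled by that of `f`
(`exists_test_field_divergence`). Pairing with `u` and moving the derivatives onto `u` bounds `⟨u -
c, f⟩`, where `c = ∫ u θ`, by the gradient of `u` times the norm of `f`. Density of test functions
bounds `‖u - c‖`, and `‖u‖ ≤ ‖u - c‖` because `u` is orthogonal to constants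
(`exists_poincare_const`).

The Dirichlet form is then coercive on zero-mean `H¹`, realised as a closed subspace of `L²(R)³`,
and Lax–Milgram gives a solution (`exists_zeroMeanH1_solution`). Since `∫ r = 0`, the weak equation
extends to all `v ∈ H¹`.

Testing with `φ` gives `E = ½ ∫ |∇φ|² ≥ 0`. If `E = 0`, then `∇φ = 0`, so the weak equation says
that `r` is orthogonal to every test function, whence `r = 0` almost everywhere. The floorplan
statement is the case where `r` is the residual density. -/

/-- Cauchy–Schwarz against the constant one, obtained by expanding `∫ (M h - I)² ≥ 0`. -/
theorem sq_integral_le_measureReal_mul {α : Type*} [MeasurableSpace α] (μ : Measure α)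
    [IsFiniteMeasure μ] {h : α → ℝ} (hi : Integrable h μ) (hi2 : Integrable (fun x => h x ^ 2) μ) :
    (∫ x, h x ∂μ) ^ 2 ≤ μ.real univ * ∫ x, h x ^ 2 ∂μ := by
  set M := μ.real univ with hM
  set I := ∫ x, h x ∂μ with hI
  have h0 : 0 ≤ ∫ x, (M * h x - I) ^ 2 ∂μ := integral_nonneg fun x => sq_nonneg _
  have h1 : ∫ x, (M * h x - I) ^ 2 ∂μ = M * (M * (∫ x, h x ^ 2 ∂μ) - I ^ 2) := by
    have : ∀ x, (M * h x - I) ^ 2 = M ^ 2 * h x ^ 2 - 2 * M * I * h x + I ^ 2 := fun x => by ring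
    simp_rw [this]
    rw [integral_add (f := fun x => M ^ 2 * h x ^ 2 - 2 * M * I * h x)
      ((hi2.const_mul _).sub (hi.const_mul _)) (integrable_const _),
      integral_sub (hi2.const_mul _) (hi.const_mul _), integral_const_mul, integral_const_mul,
      integral_const, smul_eq_mul, ← hM, ← hI]
    ring
  have hM0 : 0 ≤ M := measureReal_nonneg
  rcases hM0.eq_or_lt with h2 | h2
  · have : μ = 0 := by
      rw [← Measure.measure_univ_eq_zero]
      rw [eq_comm, hM, measureReal_eq_zero_iff] at h2
      exact h2
    simp [hI, hM, this]
  · rw [h1] at h0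
    have := nonneg_of_mul_nonneg_right h0 h2
    linarith

/-- Cauchy–Schwarz on each horizontal line bounds `W(x, y)²` independently of `x`. Integrating that
bound in `x` costs the second factor of the total mass. -/
theorem integral_sq_prod_le (μ ν : Measure ℝ) [IsFiniteMeasure μ] [IsFiniteMeasure ν]
    {W h : ℝ × ℝ → ℝ} (hW : Continuous W) (hWc : HasCompactSupport W)
    (hh : Continuous h) (hhc : HasCompactSupport h)
    (hi : ∀ y, Integrable (fun t => h (t, y)) μ)
    (hi2 : ∀ y, Integrable (fun t => h (t, y) ^ 2) μ)
    (hle : ∀ x y, |W (x, y)| ≤ ∫ t, |h (t, y)| ∂μ) :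
    ∫ z, W z ^ 2 ∂(μ.prod ν) ≤ μ.real univ ^ 2 * ∫ z, h z ^ 2 ∂(μ.prod ν) := by
  have iW : Integrable (fun z => W z ^ 2) (μ.prod ν) := by
    refine (hW.pow 2).integrable_of_hasCompactSupport ?_
    simpa [sq] using hWc.mul_left (f' := W)
  have ih : Integrable (fun z => h z ^ 2) (μ.prod ν) := by
    refine (hh.pow 2).integrable_of_hasCompactSupport ?_
    simpa [sq] using hhc.mul_left (f' := h)
  rw [integral_prod_symm _ iW, integral_prod_symm _ ih, ← integral_const_mul]
  refine integral_mono iW.integral_prod_right (ih.integral_prod_right.const_mul _) fun y => ?_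
  have key : ∀ x, W (x, y) ^ 2 ≤ μ.real univ * ∫ t, h (t, y) ^ 2 ∂μ := fun x => by
    have h1 := sq_integral_le_measureReal_mul μ (hi y).abs (by simpa using hi2 y)
    simp only [sq_abs] at h1
    refine le_trans ?_ h1
    rw [← sq_abs]
    exact pow_le_pow_left₀ (abs_nonneg _) (hle x y) 2
  calc ∫ x, W (x, y) ^ 2 ∂μ ≤ ∫ _, μ.real univ * ∫ t, h (t, y) ^ 2 ∂μ ∂μ := by
        refine integral_mono_of_nonneg (ae_of_all _ fun x => sq_nonneg _) (integrable_const _)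
          (ae_of_all _ key)
    _ = _ := by rw [integral_const, smul_eq_mul]; ring

theorem contDiff_integral_Iic {h : ℝ × ℝ → ℝ} (hh : ContDiff ℝ ∞ h) {k : Set ℝ}
    (hk : IsCompact k) (hs : ∀ x y, x ∉ k → h (x, y) = 0) :
    ContDiff ℝ ∞ (fun p : ℝ × ℝ => ∫ t in Iic p.1, h (t, p.2)) := by
  have hf : LocallyIntegrable ((Ici (0 : ℝ)).indicator fun _ => (1 : ℝ)) volume :=
    (locallyIntegrable_const _).indicator measurableSet_Ici
  -- The primitive is the convolution in `x` of `h(·, y)` with the indicator of `[0, ∞)`, so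
  -- smoothness in `(x, y)` follows from that of convolutions with a parameter.
  have := contDiffOn_convolution_right_with_param_comp (𝕜 := ℝ) (n := ⊤)
    (ContinuousLinearMap.mul ℝ ℝ) (s := (univ : Set (ℝ × ℝ))) (v := Prod.fst)
    (g := fun p x => h (x, p.2)) (k := k) (μ := volume) contDiffOn_fst isOpen_univ hk
    (fun p x _ hx => hs x _ hx) hf (by
      refine ContDiff.contDiffOn ?_
      exact hh.comp (contDiff_snd.prodMk (contDiff_snd.comp contDiff_fst)))
  rw [contDiffOn_univ] at this
  convert this using 2 with p
  rw [convolution_def, ← integral_indicator measurableSet_Iic, ← integral_sub_left_eq_self _ _ p.1]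
  congr 1
  ext t
  by_cases ht : 0 ≤ t <;> simp [indicator, ht]

theorem hasDerivAt_integral_Iic {f : ℝ → ℝ} (hf : Continuous f) (hi : Integrable f) (x : ℝ) :
    HasDerivAt (fun x => ∫ t in Iic x, f t) (f x) x := by
  have h : (fun x => ∫ t in Iic x, f t) = fun x => (∫ t in Iic 0, f t) + ∫ t in (0 : ℝ)..x, f t := by
    ext x
    rw [← intervalIntegral.integral_Iic_sub_Iic hi.integrableOn hi.integrableOn]
    ring
  rw [h]
  exact (intervalIntegral.integral_hasDerivAt_right (hf.intervalIntegrable _ _)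
    hf.stronglyMeasurable.stronglyMeasurableAtFilter hf.continuousAt).const_add _

theorem exists_Icc_of_isCompact_subset_Ioo {a b : ℝ} {k : Set ℝ} (hk : IsCompact k)
    (hkab : k ⊆ Ioo a b) : ∃ α β, Icc α β ⊆ Ioo a b ∧ k ⊆ Icc α β := by
  rcases k.eq_empty_or_nonempty with rfl | hne
  -- `Icc 1 0` is empty.
  · exact ⟨1, 0, by simp, by simp⟩
  · refine ⟨sInf k, sSup k, ?_, subset_Icc_csInf_csSup hk.bddBelow hk.bddAbove⟩
    exact Icc_subset_Ioo (hkab (hk.sInf_mem hne)).1 (hkab (hk.sSup_mem hne)).2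

variable {a₁ b₁ a₂ b₂ : ℝ}

theorem IsTestFunction.exists_box {f : ℝ × ℝ → ℝ}
    (hf : IsTestFunction (rectangle a₁ b₁ a₂ b₂) f) :
    ∃ α₁ β₁ α₂ β₂, Icc α₁ β₁ ⊆ Ioo a₁ b₁ ∧ Icc α₂ β₂ ⊆ Ioo a₂ b₂ ∧
      (∀ x y, x ∉ Icc α₁ β₁ → f (x, y) = 0) ∧ (∀ x y, y ∉ Icc α₂ β₂ → f (x, y) = 0) := by
  have hc : IsCompact (tsupport f) := hf.compactSupport
  obtain ⟨α₁, β₁, h1, k1⟩ := exists_Icc_of_isCompact_subset_Ioo (a := a₁) (b := b₁)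
    (hc.image continuous_fst) (by
      rintro _ ⟨p, hp, rfl⟩
      exact (hf.support_subset hp).1)
  obtain ⟨α₂, β₂, h2, k2⟩ := exists_Icc_of_isCompact_subset_Ioo (a := a₂) (b := b₂)
    (hc.image continuous_snd) (by
      rintro _ ⟨p, hp, rfl⟩
      exact (hf.support_subset hp).2)
  refine ⟨α₁, β₁, α₂, β₂, h1, h2, fun x y hx => ?_, fun x y hy => ?_⟩
  · by_contra h
    exact hx (k1 ⟨(x, y), subset_tsupport f h, rfl⟩)
  · by_contra h
    exact hy (k2 ⟨(x, y), subset_tsupport f h, rfl⟩)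

theorem isTestFunction_of_box {f : ℝ × ℝ → ℝ} (hf : ContDiff ℝ ∞ f) {α₁ β₁ α₂ β₂ : ℝ}
    (h1 : Icc α₁ β₁ ⊆ Ioo a₁ b₁) (h2 : Icc α₂ β₂ ⊆ Ioo a₂ b₂)
    (k1 : ∀ x y, x ∉ Icc α₁ β₁ → f (x, y) = 0) (k2 : ∀ x y, y ∉ Icc α₂ β₂ → f (x, y) = 0) :
    IsTestFunction (rectangle a₁ b₁ a₂ b₂) f := by
  have hsub : tsupport f ⊆ Icc α₁ β₁ ×ˢ Icc α₂ β₂ := by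
    refine closure_minimal ?_ (isClosed_Icc.prod isClosed_Icc)
    rintro ⟨x, y⟩ hp
    by_contra hn
    rw [mem_prod, not_and_or] at hn
    rcases hn with hn | hn
    · exact hp (k1 x y hn)
    · exact hp (k2 x y hn)
  exact ⟨hf, (isCompact_Icc.prod isCompact_Icc).of_isClosed_subset (isClosed_tsupport f) hsub,
    hsub.trans (prod_mono h1 h2)⟩

theorem IsTestFunction.swap {f : ℝ × ℝ → ℝ} (hf : IsTestFunction (rectangle a₁ b₁ a₂ b₂) f) :
    IsTestFunction (rectangle a₂ b₂ a₁ b₁) (f ∘ Prod.swap) := by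
  obtain ⟨α₁, β₁, α₂, β₂, h1, h2, k1, k2⟩ := hf.exists_box
  exact isTestFunction_of_box (hf.smooth.comp (contDiff_snd.prodMk contDiff_fst)) h2 h1
    (fun x y hx => k2 y x hx) (fun x y hx => k1 y x hx)

theorem volume_restrict_rectangle :
    (volume.restrict (rectangle a₁ b₁ a₂ b₂) : Measure (ℝ × ℝ)) =
      (volume.restrict (Ioo a₁ b₁)).prod (volume.restrict (Ioo a₂ b₂)) := by
  rw [Measure.prod_restrict]; rfl

theorem integrable_of_continuous_of_box {f : ℝ → ℝ} (hf : Continuous f) {α β : ℝ}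
    (hs : ∀ x, x ∉ Icc α β → f x = 0) (μ : Measure ℝ) [IsFiniteMeasureOnCompacts μ] :
    Integrable f μ :=
  hf.integrable_of_hasCompactSupport (HasCompactSupport.intro isCompact_Icc hs)

/-- Integrating from the left along horizontal lines gives a smooth `W`. The zero line integrals
make `W` vanish to the right of the support of `h`, so compact support inside the rectangle is kept.
-/
theorem exists_primitive_fst (hab : a₁ < b₁) {h : ℝ × ℝ → ℝ}
    (hh : IsTestFunction (rectangle a₁ b₁ a₂ b₂) h) (h0 : ∀ y, ∫ t, h (t, y) = 0) :
    ∃ W, IsTestFunction (rectangle a₁ b₁ a₂ b₂) W ∧ (∀ p, fderiv ℝ W p (1, 0) = h p) ∧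
      ∫ x in rectangle a₁ b₁ a₂ b₂, W x ^ 2 ≤
        (b₁ - a₁) ^ 2 * ∫ x in rectangle a₁ b₁ a₂ b₂, h x ^ 2 := by
  obtain ⟨α₁, β₁, α₂, β₂, h1, h2, k1, k2⟩ := hh.exists_box
  have hc : ∀ y, Continuous fun t => h (t, y) := fun y =>
    hh.smooth.continuous.comp (by fun_prop)
  have hi : ∀ (μ : Measure ℝ) [IsFiniteMeasureOnCompacts μ] y, Integrable (fun t => h (t, y)) μ :=
    fun μ _ y => integrable_of_continuous_of_box (hc y) (fun x => k1 x y) μ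
  let W : ℝ × ℝ → ℝ := fun p => ∫ t in Iic p.1, h (t, p.2)
  have hW : ContDiff ℝ ∞ W := contDiff_integral_Iic hh.smooth isCompact_Icc k1
  have hWt : IsTestFunction (rectangle a₁ b₁ a₂ b₂) W := by
    refine isTestFunction_of_box hW h1 h2 (fun x y hx => ?_) (fun x y hy => ?_)
    · rw [mem_Icc, not_and_or, not_le, not_le] at hx
      rcases hx with hx | hx
      · refine setIntegral_eq_zero_of_forall_eq_zero fun t ht => k1 t y fun h' => ?_
        exact absurd (h'.1.trans ht) (not_le.2 hx)
      · change ∫ t in Iic x, h (t, y) = 0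
        rw [setIntegral_eq_integral_of_forall_compl_eq_zero, h0]
        intro t ht
        exact k1 t y fun h' => ht (h'.2.trans hx.le)
    · simp [W, k2 _ y hy]
  refine ⟨W, hWt, ?_, ?_⟩
  · rintro ⟨x, y⟩
    have e1 : HasDerivAt (fun s => W (s, y)) (fderiv ℝ W (x, y) (1, 0)) x := by
      have := (hW.differentiable (by simp) (x, y)).hasFDerivAt.comp_hasDerivAt x
        ((hasDerivAt_id x).prodMk (hasDerivAt_const x y))
      exact this
    exact e1.unique (hasDerivAt_integral_Iic (hc y) (hi _ y) x)
  · rw [volume_restrict_rectangle]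
    have := integral_sq_prod_le (volume.restrict (Ioo a₁ b₁)) (volume.restrict (Ioo a₂ b₂))
      hWt.smooth.continuous hWt.compactSupport hh.smooth.continuous hh.compactSupport
      (fun y => hi _ y) (fun y => integrable_of_continuous_of_box ((hc y).pow 2)
        (α := α₁) (β := β₁) (fun x hx => by simp [k1 x y hx]) _) (fun x y => by
          have e : ∫ t in Ioo a₁ b₁, |h (t, y)| = ∫ t, |h (t, y)| := by
            refine setIntegral_eq_integral_of_forall_compl_eq_zero fun t ht => ?_
            rw [k1 t y fun h' => ht (h1 h'), abs_zero]
          rw [e]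
          exact (abs_integral_le_integral_abs).trans
            (setIntegral_le_integral (hi _ y).abs (ae_of_all _ fun _ => abs_nonneg _)))
    simpa [Real.volume_real_Ioo_of_le hab.le] using this

theorem setIntegral_rectangle_swap (f : ℝ × ℝ → ℝ) :
    ∫ x in rectangle a₁ b₁ a₂ b₂, f x.swap = ∫ x in rectangle a₂ b₂ a₁ b₁, f x := by
  rw [volume_restrict_rectangle, volume_restrict_rectangle]
  exact integral_prod_swap f

theorem exists_primitive_snd (hab : a₂ < b₂) {h : ℝ × ℝ → ℝ}
    (hh : IsTestFunction (rectangle a₁ b₁ a₂ b₂) h) (h0 : ∀ x, ∫ t, h (x, t) = 0) :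
    ∃ W, IsTestFunction (rectangle a₁ b₁ a₂ b₂) W ∧ (∀ p, fderiv ℝ W p (0, 1) = h p) ∧
      ∫ x in rectangle a₁ b₁ a₂ b₂, W x ^ 2 ≤
        (b₂ - a₂) ^ 2 * ∫ x in rectangle a₁ b₁ a₂ b₂, h x ^ 2 := by
  obtain ⟨W, hW, hd, hb⟩ := exists_primitive_fst hab hh.swap h0
  refine ⟨W ∘ Prod.swap, hW.swap, fun p => ?_, ?_⟩
  · have := ((hW.smooth.differentiable (by simp) p.swap).hasFDerivAt.comp p
      (ContinuousLinearEquiv.prodComm ℝ ℝ ℝ).hasFDerivAt).fderiv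
    have e : W ∘ Prod.swap = W ∘ (ContinuousLinearEquiv.prodComm ℝ ℝ ℝ) := rfl
    rw [e] at this ⊢
    rw [this]
    simpa using hd p.swap
  · have e1 := setIntegral_rectangle_swap (a₁ := a₁) (b₁ := b₁) (a₂ := a₂) (b₂ := b₂)
      (fun x => W x ^ 2)
    have e2 := setIntegral_rectangle_swap (a₁ := a₂) (b₁ := b₂) (a₂ := a₁) (b₂ := b₁)
      (fun x => h x ^ 2)
    simp only [Function.comp_apply] at hb ⊢
    rw [e1, ← e2]
    exact hb

end

/-! ### Test functions as divergences. -/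

section

theorem exists_bump_integral_eq_one {a b : ℝ} (hab : a < b) :
    ∃ (χ : ℝ → ℝ) (α β : ℝ), ContDiff ℝ ∞ χ ∧ Icc α β ⊆ Ioo a b ∧
      (∀ x, x ∉ Icc α β → χ x = 0) ∧ ∫ x, χ x = 1 := by
  let B : ContDiffBump ((a + b) / 2) :=
    ⟨(b - a) / 8, (b - a) / 4, by linarith, by linarith⟩
  refine ⟨B.normed volume, (a + b) / 2 - (b - a) / 4, (a + b) / 2 + (b - a) / 4,
    B.contDiff_normed, Icc_subset_Ioo (by linarith) (by linarith), fun x hx => ?_,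
    B.integral_normed⟩
  by_contra h
  have : x ∈ Function.support (B.normed volume) := h
  rw [B.support_normed_eq, Real.ball_eq_Ioo] at this
  exact hx (Ioo_subset_Icc_self this)

theorem IsTestFunction.sub {R : Set (ℝ × ℝ)} {f g : ℝ × ℝ → ℝ} (hf : IsTestFunction R f)
    (hg : IsTestFunction R g) : IsTestFunction R (fun x => f x - g x) where
  smooth := hf.smooth.sub hg.smooth
  compactSupport := HasCompactSupport.sub hf.compactSupport hg.compactSupport
  support_subset := (tsupport_sub f g).trans (union_subset hf.support_subset hg.support_subset)

theorem IsTestFunction.const_mul {R : Set (ℝ × ℝ)} {f : ℝ × ℝ → ℝ} (hf : IsTestFunction R f)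
    (c : ℝ) : IsTestFunction R (fun x => c * f x) where
  smooth := contDiff_const.mul hf.smooth
  compactSupport := hf.compactSupport.mul_left (f := fun _ => c)
  support_subset := (tsupport_mul_subset_right (f := fun _ => c) (g := f)).trans hf.support_subset

theorem IsTestFunction.integrable {R : Set (ℝ × ℝ)} {f : ℝ × ℝ → ℝ} (hf : IsTestFunction R f)
    (μ : Measure (ℝ × ℝ)) [IsFiniteMeasureOnCompacts μ] : Integrable f μ :=
  hf.smooth.continuous.integrable_of_hasCompactSupport hf.compactSupport

theorem IsTestFunction.integrable_sq {R : Set (ℝ × ℝ)} {f : ℝ × ℝ → ℝ} (hf : IsTestFunction R f)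
    (μ : Measure (ℝ × ℝ)) [IsFiniteMeasureOnCompacts μ] : Integrable (fun x => f x ^ 2) μ := by
  refine (hf.smooth.continuous.pow 2).integrable_of_hasCompactSupport ?_
  simpa [sq] using hf.compactSupport.mul_left (f' := f)

variable {a₁ b₁ a₂ b₂ : ℝ}

theorem isTestFunction_mul {p q : ℝ → ℝ} (hp : ContDiff ℝ ∞ p) (hq : ContDiff ℝ ∞ q)
    {α₁ β₁ α₂ β₂ : ℝ} (h1 : Icc α₁ β₁ ⊆ Ioo a₁ b₁) (h2 : Icc α₂ β₂ ⊆ Ioo a₂ b₂)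
    (k1 : ∀ x, x ∉ Icc α₁ β₁ → p x = 0) (k2 : ∀ x, x ∉ Icc α₂ β₂ → q x = 0) :
    IsTestFunction (rectangle a₁ b₁ a₂ b₂) (fun z => p z.1 * q z.2) :=
  isTestFunction_of_box ((hp.comp contDiff_fst).mul (hq.comp contDiff_snd)) h1 h2
    (fun x y hx => by simp [k1 x hx]) (fun x y hy => by simp [k2 y hy])

/-- The full line integral is the primitive evaluated at `β`, beyond which `h` vanishes. -/
theorem contDiff_integral_fst {h : ℝ × ℝ → ℝ} (hh : ContDiff ℝ ∞ h) {α β : ℝ}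
    (hs : ∀ x y, x ∉ Icc α β → h (x, y) = 0) :
    ContDiff ℝ ∞ (fun y => ∫ t, h (t, y)) := by
  have := (contDiff_integral_Iic hh isCompact_Icc hs).comp
    (contDiff_const (c := β).prodMk contDiff_id)
  convert this using 2 with y
  simp only [Function.comp_apply, id]
  rw [setIntegral_eq_integral_of_forall_compl_eq_zero]
  intro t ht
  exact hs t y fun h' => ht h'.2

theorem sub_sq_le_two_mul_sq_add (x y : ℝ) : (x - y) ^ 2 ≤ 2 * x ^ 2 + 2 * y ^ 2 := by
  nlinarith [sq_nonneg (x + y)]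

theorem integral_sub_sq_le {α : Type*} [MeasurableSpace α] {μ : Measure α} {f g : α → ℝ}
    (hf : Integrable (fun x => f x ^ 2) μ) (hg : Integrable (fun x => g x ^ 2) μ) :
    ∫ x, (f x - g x) ^ 2 ∂μ ≤ 2 * ∫ x, f x ^ 2 ∂μ + 2 * ∫ x, g x ^ 2 ∂μ := by
  rw [← integral_const_mul, ← integral_const_mul,
    ← integral_add (hf.const_mul 2) (hg.const_mul 2)]
  exact integral_mono_of_nonneg (ae_of_all _ fun x => sq_nonneg _)
    ((hf.const_mul 2).add (hg.const_mul 2)) (ae_of_all _ fun x => sub_sq_le_two_mul_sq_add _ _)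

/-- Test functions modulo a fixed one are divergences of test fields, with an `L²` bound. -/
theorem exists_test_field_divergence (h₁ : a₁ < b₁) (h₂ : a₂ < b₂) :
    ∃ (θ : ℝ × ℝ → ℝ) (C : ℝ), IsTestFunction (rectangle a₁ b₁ a₂ b₂) θ ∧ 0 ≤ C ∧
      ∀ f, IsTestFunction (rectangle a₁ b₁ a₂ b₂) f →
        ∃ w₁ w₂, IsTestFunction (rectangle a₁ b₁ a₂ b₂) w₁ ∧
          IsTestFunction (rectangle a₁ b₁ a₂ b₂) w₂ ∧
          (∀ p, f p - (∫ x in rectangle a₁ b₁ a₂ b₂, f x) * θ p =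
            fderiv ℝ w₁ p (1, 0) + fderiv ℝ w₂ p (0, 1)) ∧
          ∫ x in rectangle a₁ b₁ a₂ b₂, w₁ x ^ 2 ≤ C * ∫ x in rectangle a₁ b₁ a₂ b₂, f x ^ 2 ∧
          ∫ x in rectangle a₁ b₁ a₂ b₂, w₂ x ^ 2 ≤
            C * ∫ x in rectangle a₁ b₁ a₂ b₂, f x ^ 2 := by
  obtain ⟨p, γ₁, δ₁, hp, sp, zp, ip⟩ := exists_bump_integral_eq_one h₁
  obtain ⟨q, γ₂, δ₂, hq, sq', zq, iq⟩ := exists_bump_integral_eq_one h₂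
  set μ : Measure ℝ := volume.restrict (Ioo a₁ b₁) with hμ
  set ν : Measure ℝ := volume.restrict (Ioo a₂ b₂) with hν
  have hR : (volume.restrict (rectangle a₁ b₁ a₂ b₂) : Measure (ℝ × ℝ)) = μ.prod ν :=
    volume_restrict_rectangle
  set P := ∫ x, p x ^ 2 ∂μ with hP
  set Q := ∫ x, q x ^ 2 ∂ν with hQ
  have hP0 : 0 ≤ P := integral_nonneg fun x => sq_nonneg _
  have hQ0 : 0 ≤ Q := integral_nonneg fun x => sq_nonneg _
  set M := μ.real univ with hM
  set N := (μ.prod ν).real univ with hN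
  have hM0 : 0 ≤ M := measureReal_nonneg
  have hN0 : 0 ≤ N := measureReal_nonneg
  -- `D` dominates both constants that arise below: `2 + 2PM` for `f - G` and `2PM + 2NPQ` for `G -
  -- m θ`.
  set D := 2 + 2 * (P * M) + 2 * (N * (P * Q)) with hD
  have hD0 : 0 ≤ D := by positivity
  set θ : ℝ × ℝ → ℝ := fun z => p z.1 * q z.2 with hθ
  have hθt : IsTestFunction (rectangle a₁ b₁ a₂ b₂) θ :=
    isTestFunction_mul hp hq sp sq' zp zq
  have hθ2 : ∫ z, θ z ^ 2 ∂(μ.prod ν) = P * Q := by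
    rw [hP, hQ, ← integral_prod_mul]
    simp only [hθ, mul_pow]
  refine ⟨θ, (b₁ - a₁) ^ 2 * D + (b₂ - a₂) ^ 2 * D, hθt, by positivity, fun f hf => ?_⟩
  obtain ⟨α₁, β₁, α₂, β₂, s1, s2, k1, k2⟩ := hf.exists_box
  set F : ℝ → ℝ := fun y => ∫ t, f (t, y) with hF
  have hFs : ContDiff ℝ ∞ F := contDiff_integral_fst hf.smooth k1
  have hFz : ∀ y, y ∉ Icc α₂ β₂ → F y = 0 := fun y hy => by simp [hF, k2 _ y hy]
  have hc : ∀ y, Continuous fun t => f (t, y) := fun y =>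
    hf.smooth.continuous.comp (by fun_prop)
  have hFμ : ∀ y, F y = ∫ t, f (t, y) ∂μ := fun y => by
    refine (setIntegral_eq_integral_of_forall_compl_eq_zero fun t ht => ?_).symm
    exact k1 t y fun h' => ht (s1 h')
  set m := ∫ x in rectangle a₁ b₁ a₂ b₂, f x with hm
  have hmF : ∫ y, F y = m := by
    rw [hm, hR, integral_prod_symm _ (hf.integrable _)]
    simp_rw [← hFμ]
    refine (setIntegral_eq_integral_of_forall_compl_eq_zero fun t ht => ?_).symm
    exact hFz t fun h' => ht (s2 h')
  set S := ∫ x in rectangle a₁ b₁ a₂ b₂, f x ^ 2 with hS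
  have hS0 : 0 ≤ S := integral_nonneg fun x => sq_nonneg _
  have hF2 : ∫ y, F y ^ 2 ∂ν ≤ M * S := by
    rw [hS, hR, integral_prod_symm _ (hf.integrable_sq _), ← integral_const_mul]
    refine integral_mono_of_nonneg (ae_of_all _ fun y => sq_nonneg _)
      ((hf.integrable_sq (μ.prod ν)).integral_prod_right.const_mul _) (ae_of_all _ fun y => ?_)
    simp only [hFμ]
    exact sq_integral_le_measureReal_mul μ (integrable_of_continuous_of_box (hc y)
      (fun x => k1 x y) _) (integrable_of_continuous_of_box ((hc y).pow 2) (α := α₁) (β := β₁)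
      (fun x hx => by simp [k1 x y hx]) _)
  have hm2 : m ^ 2 ≤ N * S := by
    rw [hm, hS, hR]
    exact sq_integral_le_measureReal_mul _ (hf.integrable _) (hf.integrable_sq _)
  -- `G` interpolates between `f` and `m θ`. It has the same integral as `f` on each horizontal line
  -- and the same integral as `m θ` on each vertical line, so both differences have primitives in
  -- their own direction.
  set G : ℝ × ℝ → ℝ := fun z => p z.1 * F z.2 with hG
  have hGt : IsTestFunction (rectangle a₁ b₁ a₂ b₂) G :=
    isTestFunction_mul hp hFs sp s2 zp hFz
  have hG2 : ∫ z in rectangle a₁ b₁ a₂ b₂, G z ^ 2 ≤ P * (M * S) := by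
    have : ∫ z, G z ^ 2 ∂(μ.prod ν) = P * ∫ y, F y ^ 2 ∂ν := by
      rw [hP, ← integral_prod_mul]
      simp only [hG, mul_pow]
    rw [hR, this]
    exact mul_le_mul_of_nonneg_left hF2 hP0
  have b1 : ∫ z in rectangle a₁ b₁ a₂ b₂, (f z - G z) ^ 2 ≤ D * S := by
    refine (integral_sub_sq_le (hf.integrable_sq _) (hGt.integrable_sq _)).trans ?_
    have : 0 ≤ N * (P * Q) * S := by positivity
    rw [hD]; nlinarith
  have b2 : ∫ z in rectangle a₁ b₁ a₂ b₂, (G z - m * θ z) ^ 2 ≤ D * S := by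
    refine (integral_sub_sq_le (hGt.integrable_sq _)
      ((hθt.const_mul m).integrable_sq _)).trans ?_
    have e : ∫ z in rectangle a₁ b₁ a₂ b₂, (m * θ z) ^ 2 = m ^ 2 * (P * Q) := by
      simp_rw [mul_pow]
      rw [integral_const_mul, hR, hθ2]
    have e2 : m ^ 2 * (P * Q) ≤ N * S * (P * Q) :=
      mul_le_mul_of_nonneg_right hm2 (by positivity)
    rw [e, hD]; nlinarith
  obtain ⟨w₁, hw₁, d1, B1⟩ := exists_primitive_fst h₁ (hf.sub hGt) (fun y => by
    change ∫ t, (f (t, y) - p t * F y) = 0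
    rw [integral_sub (integrable_of_continuous_of_box (hc y) (fun x => k1 x y) _)
      ((integrable_of_continuous_of_box hp.continuous zp _).mul_const _), integral_mul_const, ip,
      one_mul, sub_self])
  obtain ⟨w₂, hw₂, d2, B2⟩ := exists_primitive_snd h₂ (hGt.sub (hθt.const_mul m)) (fun x => by
    change ∫ t, (p x * F t - m * (p x * q t)) = 0
    rw [integral_sub ((integrable_of_continuous_of_box hFs.continuous hFz _).const_mul _)
      (((integrable_of_continuous_of_box hq.continuous zq _).const_mul _).const_mul _),
      integral_const_mul, integral_const_mul, integral_const_mul, iq, hmF]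
    ring)
  refine ⟨w₁, w₂, hw₁, hw₂, fun z => by rw [d1, d2]; ring, ?_, ?_⟩
  · have := mul_le_mul_of_nonneg_left b1 (sq_nonneg (b₁ - a₁))
    have h3 : 0 ≤ (b₂ - a₂) ^ 2 * D * S := by positivity
    refine B1.trans (this.trans ?_)
    linarith
  · have := mul_le_mul_of_nonneg_left b2 (sq_nonneg (b₂ - a₂))
    have h3 : 0 ≤ (b₁ - a₁) ^ 2 * D * S := by positivity
    refine B2.trans (this.trans ?_)
    linarith

end

/-! ### `L²` pairings, density of test functions and the Poincaré inequality. -/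

section

section L2

variable {α : Type*} [MeasurableSpace α] {μ : Measure α} {f g : α → ℝ}

theorem _root_.MeasureTheory.MemLp.integrable_fun_mul (hf : MemLp f 2 μ) (hg : MemLp g 2 μ) :
    Integrable (fun x => f x * g x) μ :=
  MemLp.integrable_mul hf hg

theorem inner_toLp (hf : MemLp f 2 μ) (hg : MemLp g 2 μ) :
    inner ℝ (hf.toLp f) (hg.toLp g) = ∫ x, f x * g x ∂μ := by
  rw [L2.inner_def]
  refine integral_congr_ae ?_
  filter_upwards [hf.coeFn_toLp, hg.coeFn_toLp] with x h1 h2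
  rw [h1, h2, real_inner_eq_re_inner]
  simp [mul_comm]

theorem norm_toLp_sq (hf : MemLp f 2 μ) : ‖hf.toLp f‖ ^ 2 = ∫ x, f x ^ 2 ∂μ := by
  rw [← real_inner_self_eq_norm_sq, inner_toLp]
  simp_rw [sq]

theorem norm_toLp_le_of_sq_le (hf : MemLp f 2 μ) (hg : MemLp g 2 μ) {C : ℝ} (hC : 0 ≤ C)
    (h : ∫ x, f x ^ 2 ∂μ ≤ C * ∫ x, g x ^ 2 ∂μ) : ‖hf.toLp f‖ ≤ √C * ‖hg.toLp g‖ := by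
  refine (sq_le_sq₀ (norm_nonneg _) (by positivity)).1 ?_
  rwa [mul_pow, Real.sq_sqrt hC, norm_toLp_sq, norm_toLp_sq]

end L2

variable {R : Set (ℝ × ℝ)}

theorem IsTestFunction.memLp {f : ℝ × ℝ → ℝ} (hf : IsTestFunction R f) :
    MemLp f 2 (volume.restrict R) :=
  hf.smooth.continuous.memLp_of_hasCompactSupport hf.compactSupport

theorem IsTestFunction.fderiv_apply {f : ℝ × ℝ → ℝ} (hf : IsTestFunction R f) (e : ℝ × ℝ) :
    IsTestFunction R (fun x => fderiv ℝ f x e) where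
  smooth := (hf.smooth.fderiv_right (by simp)).clm_apply contDiff_const
  compactSupport := hf.compactSupport.fderiv_apply ℝ e
  support_subset := (tsupport_fderiv_apply_subset ℝ e).trans hf.support_subset

theorem IsTestFunction.add {f g : ℝ × ℝ → ℝ} (hf : IsTestFunction R f)
    (hg : IsTestFunction R g) : IsTestFunction R (fun x => f x + g x) where
  smooth := hf.smooth.add hg.smooth
  compactSupport := hf.compactSupport.add hg.compactSupport
  support_subset := (tsupport_add f g).trans (union_subset hf.support_subset hg.support_subset)

/-- Classes of test functions in `L²(R)`. -/
def testSubmodule (R : Set (ℝ × ℝ)) : Submodule ℝ (Lp ℝ 2 (volume.restrict R)) where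
  carrier := {U | ∃ (f : ℝ × ℝ → ℝ) (hf : IsTestFunction R f), U = hf.memLp.toLp f}
  add_mem' := by
    rintro _ _ ⟨f, hf, rfl⟩ ⟨g, hg, rfl⟩
    exact ⟨_, hf.add hg, rfl⟩
  zero_mem' := ⟨fun _ => 0, ⟨contDiff_const, HasCompactSupport.zero, by simp [tsupport]⟩, rfl⟩
  smul_mem' := by
    rintro c _ ⟨f, hf, rfl⟩
    exact ⟨_, hf.const_mul c, rfl⟩

theorem ae_eq_zero_of_integral_test_eq_zero (hR : IsOpen R) (hfin : volume R ≠ ⊤)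
    {r : ℝ × ℝ → ℝ} (hr : MemLp r 2 (volume.restrict R))
    (h : ∀ f, IsTestFunction R f → ∫ x in R, r x * f x = 0) : r =ᵐ[volume.restrict R] 0 := by
  have : IsFiniteMeasure (volume.restrict R) := ⟨by simpa using hfin.lt_top⟩
  have hi : IntegrableOn r R := hr.integrable one_le_two
  have := hR.ae_eq_zero_of_integral_contDiff_smul_eq_zero hi.locallyIntegrableOn
    (fun g h1 h2 h3 => by
      rw [← h g ⟨h1, h2, h3⟩, setIntegral_eq_integral_of_forall_compl_eq_zero]
      · simp [mul_comm]
      · intro x hx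
        rw [image_eq_zero_of_notMem_tsupport fun h' => hx (h3 h'), mul_zero])
  rw [Filter.EventuallyEq, ae_restrict_iff' hR.measurableSet]
  exact this

/-- An `L²` function orthogonal to all test functions vanishes, so the orthogonal complement is
trivial. -/
theorem dense_testSubmodule (hR : IsOpen R) (hfin : volume R ≠ ⊤) :
    Dense (testSubmodule R : Set (Lp ℝ 2 (volume.restrict R))) := by
  rw [Submodule.dense_iff_topologicalClosure_eq_top, Submodule.topologicalClosure_eq_top_iff,
    Submodule.eq_bot_iff]
  intro U hU
  rw [Submodule.mem_orthogonal'] at hU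
  rw [Lp.eq_zero_iff_ae_eq_zero]
  refine ae_eq_zero_of_integral_test_eq_zero hR hfin (Lp.memLp U) fun f hf => ?_
  rw [← inner_toLp (Lp.memLp U) hf.memLp, Lp.toLp_coeFn]
  exact hU _ ⟨f, hf, rfl⟩

/-- By density the bound extends to all of `L²`, and can then be applied to `U` itself. -/
theorem norm_le_of_forall_test (hR : IsOpen R) (hfin : volume R ≠ ⊤)
    {U : Lp ℝ 2 (volume.restrict R)} {K : ℝ}
    (hK : 0 ≤ K) (h : ∀ f (hf : IsTestFunction R f),
      inner ℝ U (hf.memLp.toLp f) ≤ K * ‖hf.memLp.toLp f‖) : ‖U‖ ≤ K := by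
  have hall : ∀ V, inner ℝ U V ≤ K * ‖V‖ := fun V => by
    refine (dense_testSubmodule hR hfin).induction (P := fun V => inner ℝ U V ≤ K * ‖V‖)
      ?_ (isClosed_le (by fun_prop) (by fun_prop)) V
    rintro _ ⟨f, hf, rfl⟩
    exact h f hf
  rcases eq_or_ne U 0 with h0 | h0
  · rwa [h0, norm_zero]
  · have := hall U
    rw [real_inner_self_eq_norm_sq, sq] at this
    exact le_of_mul_le_mul_right this (norm_pos_iff.2 h0)

variable {a₁ b₁ a₂ b₂ : ℝ}

theorem isOpen_rectangle : IsOpen (rectangle a₁ b₁ a₂ b₂) := isOpen_Ioo.prod isOpen_Ioo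

theorem volume_rectangle_ne_top : volume (rectangle a₁ b₁ a₂ b₂) ≠ ⊤ := by
  rw [rectangle, Measure.volume_eq_prod, Measure.prod_prod]
  exact ENNReal.mul_ne_top (by simp) (by simp)

instance isFiniteMeasure_rectangle :
    IsFiniteMeasure (volume.restrict (rectangle a₁ b₁ a₂ b₂) : Measure (ℝ × ℝ)) :=
  ⟨by simpa using volume_rectangle_ne_top.lt_top⟩

/-- The Poincaré inequality on a rectangle. -/
theorem exists_poincare_const (h₁ : a₁ < b₁) (h₂ : a₂ < b₂) :
    ∃ C : ℝ, ∀ u g₁ g₂ (h : HasH1Gradient (rectangle a₁ b₁ a₂ b₂) u g₁ g₂),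
      ∫ x in rectangle a₁ b₁ a₂ b₂, u x = 0 →
      ‖h.memLp.toLp u‖ ≤ C * (‖h.memLp_fst.toLp g₁‖ + ‖h.memLp_snd.toLp g₂‖) := by
  obtain ⟨θ, C, hθ, hC, hdiv⟩ := exists_test_field_divergence h₁ h₂
  refine ⟨√C, fun u g₁ g₂ h hu => ?_⟩
  set c := ∫ x in rectangle a₁ b₁ a₂ b₂, u x * θ x with hc
  have hcm : MemLp (fun _ : ℝ × ℝ => c) 2
      (volume.restrict (rectangle a₁ b₁ a₂ b₂)) := memLp_const c
  set U := h.memLp.toLp u with hU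
  have key : ∀ f (hf : IsTestFunction (rectangle a₁ b₁ a₂ b₂) f),
      inner ℝ (U - hcm.toLp) (hf.memLp.toLp f) ≤
        √C * (‖h.memLp_fst.toLp g₁‖ + ‖h.memLp_snd.toLp g₂‖) * ‖hf.memLp.toLp f‖ := fun f hf => by
    obtain ⟨w₁, w₂, hw₁, hw₂, hd, B1, B2⟩ := hdiv f hf
    -- The choice of `c` turns `c ∫ f` into `∫ u (∫ f) θ`, so the left side is `u` paired with the
    -- divergence of `(w₁, w₂)`.
    have e : inner ℝ (U - hcm.toLp) (hf.memLp.toLp f) =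
        -(inner ℝ (h.memLp_fst.toLp g₁) (hw₁.memLp.toLp w₁)) -
          inner ℝ (h.memLp_snd.toLp g₂) (hw₂.memLp.toLp w₂) := by
      rw [inner_sub_left, inner_toLp, inner_toLp, inner_toLp, inner_toLp, ← h.deriv_fst w₁ hw₁,
        sub_eq_add_neg _ (∫ x in _, g₂ x * w₂ x), ← h.deriv_snd w₂ hw₂, ← integral_add
          (h.memLp.integrable_fun_mul (hw₁.fderiv_apply (1, 0)).memLp)
          (h.memLp.integrable_fun_mul (hw₂.fderiv_apply (0, 1)).memLp)]
      simp_rw [← mul_add, ← hd, mul_sub]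
      rw [integral_sub (h.memLp.integrable_fun_mul hf.memLp)
        (h.memLp.integrable_fun_mul (hθ.const_mul _).memLp), integral_const_mul]
      simp_rw [mul_left_comm (u _)]
      rw [integral_const_mul, ← hc, mul_comm c]
    rw [e]
    have n1 := abs_real_inner_le_norm (h.memLp_fst.toLp g₁) (hw₁.memLp.toLp w₁)
    have n2 := abs_real_inner_le_norm (h.memLp_snd.toLp g₂) (hw₂.memLp.toLp w₂)
    have m1 := mul_le_mul_of_nonneg_left (norm_toLp_le_of_sq_le hw₁.memLp hf.memLp hC B1)
      (norm_nonneg (h.memLp_fst.toLp g₁))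
    have m2 := mul_le_mul_of_nonneg_left (norm_toLp_le_of_sq_le hw₂.memLp hf.memLp hC B2)
      (norm_nonneg (h.memLp_snd.toLp g₂))
    have := (abs_le.1 n1).1
    have := (abs_le.1 n2).1
    linarith
  -- Zero mean makes `U` orthogonal to constants, so subtracting one cannot decrease the norm.
  have hUc : ‖U‖ ≤ ‖U - hcm.toLp‖ := by
    have e : inner ℝ U (hcm.toLp) = 0 := by
      rw [inner_toLp, integral_mul_const, hu, zero_mul]
    have e2 : ‖U‖ * ‖U‖ ≤ ‖U‖ * ‖U - hcm.toLp‖ := by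
      refine le_trans (le_of_eq ?_) (real_inner_le_norm _ _)
      rw [inner_sub_right, e, sub_zero, real_inner_self_eq_norm_mul_norm]
    rcases (norm_nonneg U).eq_or_lt with h0 | h0
    · rw [← h0]; exact norm_nonneg _
    · exact le_of_mul_le_mul_left e2 h0
  exact hUc.trans
    (norm_le_of_forall_test isOpen_rectangle volume_rectangle_ne_top (by positivity) key)

end

/-! ### Zero-mean `H¹` as a closed subspace of `L²(R)³`. -/

section

/-- The Hilbert space `L²(R)³` of candidate pairs of a function and a gradient. -/
abbrev L2Triple (R : Set (ℝ × ℝ)) : Type := PiLp 2 fun _ : Fin 3 => Lp ℝ 2 (volume.restrict R)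

/-- The triple with given components. -/
noncomputable def tripleMk {R : Set (ℝ × ℝ)} (u g₁ g₂ : Lp ℝ 2 (volume.restrict R)) : L2Triple R :=
  WithLp.toLp 2 ![u, g₁, g₂]

theorem mem_orthogonal_span_iff {E : Type*} [NormedAddCommGroup E] [InnerProductSpace ℝ E]
    {S : Set E} {p : E} : p ∈ (Submodule.span ℝ S)ᗮ ↔ ∀ s ∈ S, inner ℝ s p = 0 := by
  rw [Submodule.mem_orthogonal]
  refine ⟨fun h s hs => h s (Submodule.subset_span hs), fun h s hs => ?_⟩
  induction hs using Submodule.span_induction with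
  | mem x hx => exact h x hx
  | zero => exact inner_zero_left _
  | add x y _ _ hx hy => rw [inner_add_left, hx, hy, add_zero]
  | smul c x _ hx => rw [real_inner_smul_left, hx, mul_zero]

theorem inner_triple {R : Set (ℝ × ℝ)} (p q : L2Triple R) :
    inner ℝ p q = inner ℝ (p 0) (q 0) + inner ℝ (p 1) (q 1) + inner ℝ (p 2) (q 2) := by
  rw [PiLp.inner_apply, Fin.sum_univ_three]

variable {a₁ b₁ a₂ b₂ : ℝ}

/-- The constant function one in `L²(R)`. -/
noncomputable def oneL2 (R : Set (ℝ × ℝ)) [IsFiniteMeasure (volume.restrict R)] : Lp ℝ 2 (volume.restrict R) :=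
  (memLp_const (1 : ℝ)).toLp fun _ => 1

/-- Zero-mean `H¹` functions together with their weak gradients, as a closed subspace of
`L²(R)³`. -/
noncomputable def zeroMeanH1 (R : Set (ℝ × ℝ)) [IsFiniteMeasure (volume.restrict R)] :
    Submodule ℝ (L2Triple R) :=
  (Submodule.span ℝ
    ({p | ∃ (η : ℝ × ℝ → ℝ) (h : IsTestFunction R η),
        p = tripleMk ((h.fderiv_apply (1, 0)).memLp.toLp _) (h.memLp.toLp η) 0} ∪
      {p | ∃ (η : ℝ × ℝ → ℝ) (h : IsTestFunction R η),
        p = tripleMk ((h.fderiv_apply (0, 1)).memLp.toLp _) 0 (h.memLp.toLp η)} ∪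
      {tripleMk (oneL2 R) 0 0}))ᗮ

/-- The three families of spanning vectors encode the two weak-derivative identities and the mean
condition. Defining the space as an orthogonal complement makes it closed at no cost. -/
theorem tripleMk_mem_zeroMeanH1 {R : Set (ℝ × ℝ)} [IsFiniteMeasure (volume.restrict R)]
    {u g₁ g₂ : ℝ × ℝ → ℝ} (hu : MemLp u 2 (volume.restrict R))
    (h₁ : MemLp g₁ 2 (volume.restrict R)) (h₂ : MemLp g₂ 2 (volume.restrict R)) :
    tripleMk (hu.toLp u) (h₁.toLp g₁) (h₂.toLp g₂) ∈ zeroMeanH1 R ↔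
      HasH1Gradient R u g₁ g₂ ∧ ∫ x in R, u x = 0 := by
  have e1 : ∀ η (h : IsTestFunction R η), inner ℝ
      (tripleMk ((h.fderiv_apply (1, 0)).memLp.toLp _) (h.memLp.toLp η) 0)
      (tripleMk (hu.toLp u) (h₁.toLp g₁) (h₂.toLp g₂)) =
        (∫ x in R, u x * fderiv ℝ η x (1, 0)) + ∫ x in R, g₁ x * η x := fun η h => by
    simp [inner_triple, tripleMk, inner_toLp, mul_comm]
  have e2 : ∀ η (h : IsTestFunction R η), inner ℝ
      (tripleMk ((h.fderiv_apply (0, 1)).memLp.toLp _) 0 (h.memLp.toLp η))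
      (tripleMk (hu.toLp u) (h₁.toLp g₁) (h₂.toLp g₂)) =
        (∫ x in R, u x * fderiv ℝ η x (0, 1)) + ∫ x in R, g₂ x * η x := fun η h => by
    simp [inner_triple, tripleMk, inner_toLp, mul_comm]
  have e3 : inner ℝ (tripleMk (oneL2 R) 0 0)
      (tripleMk (hu.toLp u) (h₁.toLp g₁) (h₂.toLp g₂)) = ∫ x in R, u x := by
    rw [inner_triple]
    simp only [tripleMk, oneL2, Matrix.cons_val, inner_zero_left, add_zero]
    rw [inner_toLp]
    simp
  rw [zeroMeanH1, mem_orthogonal_span_iff]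
  constructor
  · refine fun h => ⟨⟨hu, h₁, h₂, fun η hη => ?_, fun η hη => ?_⟩, ?_⟩
    · rw [eq_neg_iff_add_eq_zero, ← e1 η hη]
      exact h _ (Or.inl (Or.inl ⟨η, hη, rfl⟩))
    · rw [eq_neg_iff_add_eq_zero, ← e2 η hη]
      exact h _ (Or.inl (Or.inr ⟨η, hη, rfl⟩))
    · rw [← e3]
      exact h _ (Or.inr rfl)
  · rintro ⟨h, h0⟩ _ ((⟨η, hη, rfl⟩ | ⟨η, hη, rfl⟩) | rfl)
    · rw [e1 η hη, h.deriv_fst η hη, neg_add_cancel]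
    · rw [e2 η hη, h.deriv_snd η hη, neg_add_cancel]
    · rw [e3, h0]

theorem hasWeakDeriv_const {R : Set (ℝ × ℝ)} (e : ℝ × ℝ) (c : ℝ) :
    HasWeakDeriv R e (fun _ => c) fun _ => 0 := by
  intro η hη
  have h1 := (hη.fderiv_apply e).integrable volume
  have := integral_mul_fderiv_eq_neg_fderiv_mul_of_integrable (μ := (volume : Measure (ℝ × ℝ)))
    (f := fun _ => c) (g := η) (v := e) (by simp) (h1.const_mul c)
    ((hη.integrable volume).const_mul c) (fun x _ => differentiableAt_const c)
    (fun x _ => hη.smooth.differentiable (by simp) x)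
  rw [setIntegral_eq_integral_of_forall_compl_eq_zero, this]
  · simp
  · intro x hx
    rw [image_eq_zero_of_notMem_tsupport fun h' => hx ((hη.fderiv_apply e).support_subset h'),
      mul_zero]

theorem HasWeakDeriv.sub {R : Set (ℝ × ℝ)} {e : ℝ × ℝ} {u v g h : ℝ × ℝ → ℝ}
    (hu : HasWeakDeriv R e u g) (hv : HasWeakDeriv R e v h)
    (mu : MemLp u 2 (volume.restrict R)) (mv : MemLp v 2 (volume.restrict R))
    (mg : MemLp g 2 (volume.restrict R)) (mh : MemLp h 2 (volume.restrict R)) :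
    HasWeakDeriv R e (fun x => u x - v x) fun x => g x - h x := by
  intro η hη
  simp_rw [sub_mul]
  rw [integral_sub (mu.integrable_fun_mul (hη.fderiv_apply e).memLp)
      (mv.integrable_fun_mul (hη.fderiv_apply e).memLp),
    integral_sub (mg.integrable_fun_mul hη.memLp) (mh.integrable_fun_mul hη.memLp),
    hu η hη, hv η hη]
  ring

theorem HasH1Gradient.sub {R : Set (ℝ × ℝ)} {u v g₁ g₂ h₁ h₂ : ℝ × ℝ → ℝ}
    (hu : HasH1Gradient R u g₁ g₂) (hv : HasH1Gradient R v h₁ h₂) :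
    HasH1Gradient R (fun x => u x - v x) (fun x => g₁ x - h₁ x) fun x => g₂ x - h₂ x where
  memLp := hu.memLp.sub hv.memLp
  memLp_fst := hu.memLp_fst.sub hv.memLp_fst
  memLp_snd := hu.memLp_snd.sub hv.memLp_snd
  deriv_fst := hu.deriv_fst.sub hv.deriv_fst hu.memLp hv.memLp hu.memLp_fst hv.memLp_fst
  deriv_snd := hu.deriv_snd.sub hv.deriv_snd hu.memLp hv.memLp hu.memLp_snd hv.memLp_snd

theorem hasH1Gradient_const {R : Set (ℝ × ℝ)} [IsFiniteMeasure (volume.restrict R)] (c : ℝ) :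
    HasH1Gradient R (fun _ => c) (fun _ => 0) fun _ => 0 :=
  ⟨memLp_const c, memLp_const 0, memLp_const 0, hasWeakDeriv_const _ c, hasWeakDeriv_const _ c⟩

/-- Lets the weak equation, solved against zero-mean functions, be tested against an arbitrary `H¹`
function. -/
theorem HasH1Gradient.exists_sub_const {u g₁ g₂ : ℝ × ℝ → ℝ} {R : Set (ℝ × ℝ)}
    [IsFiniteMeasure (volume.restrict R)] (h0 : volume.real R ≠ 0)
    (hu : HasH1Gradient R u g₁ g₂) :
    ∃ c, HasH1Gradient R (fun x => u x - c) g₁ g₂ ∧ ∫ x in R, (u x - c) = 0 := by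
  refine ⟨(∫ x in R, u x) / volume.real R, ?_, ?_⟩
  · simpa using hu.sub (hasH1Gradient_const ((∫ x in R, u x) / volume.real R))
  · rw [integral_sub (hu.memLp.integrable one_le_two) (integrable_const _), setIntegral_const,
      smul_eq_mul, mul_div_cancel₀ _ h0, sub_self]

theorem IsTestFunction.hasWeakDeriv {R : Set (ℝ × ℝ)} {f : ℝ × ℝ → ℝ} (hf : IsTestFunction R f)
    (e : ℝ × ℝ) : HasWeakDeriv R e f fun x => fderiv ℝ f x e := by
  intro η hη
  have hz : ∀ {g : ℝ × ℝ → ℝ} (_ : IsTestFunction R g) (k : ℝ × ℝ → ℝ),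
      ∫ x in R, k x * g x = ∫ x, k x * g x := fun hg k =>
    setIntegral_eq_integral_of_forall_compl_eq_zero fun x hx => by
      rw [image_eq_zero_of_notMem_tsupport fun h' => hx (hg.support_subset h'), mul_zero]
  have hi : ∀ {g k : ℝ × ℝ → ℝ} (_ : IsTestFunction R g) (_ : IsTestFunction R k),
      Integrable (fun x => k x * g x) volume := fun hg hk =>
    (hk.smooth.continuous.mul hg.smooth.continuous).integrable_of_hasCompactSupport
      hg.compactSupport.mul_left
  rw [hz (hη.fderiv_apply e), hz hη]
  exact integral_mul_fderiv_eq_neg_fderiv_mul_of_integrable (hi hη (hf.fderiv_apply e))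
    (hi (hη.fderiv_apply e) hf) (hi hη hf) (fun x _ => hf.smooth.differentiable (by simp) x)
    (fun x _ => hη.smooth.differentiable (by simp) x)

/-- Makes test functions admissible in the weak equation, which is how `r` is recovered from `∇φ`.
-/
theorem IsTestFunction.hasH1Gradient {R : Set (ℝ × ℝ)} {f : ℝ × ℝ → ℝ}
    (hf : IsTestFunction R f) :
    HasH1Gradient R f (fun x => fderiv ℝ f x (1, 0)) fun x => fderiv ℝ f x (0, 1) :=
  ⟨hf.memLp, (hf.fderiv_apply _).memLp, (hf.fderiv_apply _).memLp, hf.hasWeakDeriv _,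
    hf.hasWeakDeriv _⟩

end

/-! ### Lax–Milgram, uniqueness and the energy. -/

section

theorem exists_zeroMeanH1_solution {R : Set (ℝ × ℝ)} [IsFiniteMeasure (volume.restrict R)]
    {C : ℝ} (hP : ∀ p ∈ zeroMeanH1 R, ‖p 0‖ ≤ C * (‖p 1‖ + ‖p 2‖))
    (r : Lp ℝ 2 (volume.restrict R)) :
    ∃ p ∈ zeroMeanH1 R, ∀ q ∈ zeroMeanH1 R,
      inner ℝ (p 1) (q 1) + inner ℝ (p 2) (q 2) = inner ℝ r (q 0) := by
  have : CompleteSpace (zeroMeanH1 R) := by unfold zeroMeanH1; infer_instance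
  let π (i : Fin 3) : zeroMeanH1 R →L[ℝ] Lp ℝ 2 (volume.restrict R) :=
    (PiLp.proj 2 (fun _ : Fin 3 => Lp ℝ 2 (volume.restrict R)) i).comp (zeroMeanH1 R).subtypeL
  let B : zeroMeanH1 R →L[ℝ] zeroMeanH1 R →L[ℝ] ℝ :=
    (innerSL ℝ).bilinearComp (π 1) (π 1) + (innerSL ℝ).bilinearComp (π 2) (π 2)
  have hB : ∀ p q : zeroMeanH1 R,
      B p q = inner ℝ (p.1 1) (q.1 1) + inner ℝ (p.1 2) (q.1 2) := fun p q => rfl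
  have hco : IsCoercive B := by
    -- The norm on the triple includes `p 0`. Poincaré and `(a + b)² ≤ 2a² + 2b²` give `‖p‖² ≤ (2C²
    -- + 1) B(p, p)`.
    refine ⟨(2 * C ^ 2 + 1)⁻¹, by positivity, fun p => ?_⟩
    rw [mul_assoc, inv_mul_le_iff₀ (by positivity), hB, real_inner_self_eq_norm_mul_norm,
      real_inner_self_eq_norm_mul_norm, Submodule.coe_norm, ← real_inner_self_eq_norm_mul_norm,
      inner_triple, real_inner_self_eq_norm_mul_norm, real_inner_self_eq_norm_mul_norm,
      real_inner_self_eq_norm_mul_norm]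
    have h1 := mul_self_le_mul_self (norm_nonneg _) (hP p.1 p.2)
    have h2 := mul_nonneg (sq_nonneg C) (sq_nonneg (‖p.1 1‖ - ‖p.1 2‖))
    linarith
  -- The vector `(π 0).adjoint r` represents the functional `q ↦ ⟨r, q 0⟩`.
  refine ⟨hco.continuousLinearEquivOfBilin.symm ((π 0).adjoint r), Subtype.coe_prop _,
    fun q hq => ?_⟩
  have := hco.continuousLinearEquivOfBilin_apply
    (hco.continuousLinearEquivOfBilin.symm ((π 0).adjoint r)) ⟨q, hq⟩
  rw [ContinuousLinearEquiv.apply_symm_apply, ContinuousLinearMap.adjoint_inner_left, hB] at this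
  exact this.symm

variable {a₁ b₁ a₂ b₂ : ℝ}

theorem tripleMk_toLp_coeFn {R : Set (ℝ × ℝ)} (p : L2Triple R) :
    tripleMk ((Lp.memLp (p 0)).toLp (p 0)) ((Lp.memLp (p 1)).toLp (p 1))
      ((Lp.memLp (p 2)).toLp (p 2)) = p := by
  simp only [Lp.toLp_coeFn]
  ext i : 1
  fin_cases i <;> rfl

theorem zeroMeanH1_poincare (h₁ : a₁ < b₁) (h₂ : a₂ < b₂) :
    ∃ C : ℝ, ∀ p ∈ zeroMeanH1 (rectangle a₁ b₁ a₂ b₂), ‖p 0‖ ≤ C * (‖p 1‖ + ‖p 2‖) := by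
  obtain ⟨C, h⟩ := exists_poincare_const h₁ h₂
  refine ⟨C, fun p hp => ?_⟩
  rw [← tripleMk_toLp_coeFn p, tripleMk_mem_zeroMeanH1] at hp
  simpa only [Lp.toLp_coeFn] using h _ _ _ hp.1 hp.2

theorem volume_real_rectangle_ne_zero (h₁ : a₁ < b₁) (h₂ : a₂ < b₂) :
    volume.real (rectangle a₁ b₁ a₂ b₂) ≠ 0 := by
  rw [rectangle, Measure.volume_eq_prod, measureReal_prod_prod,
    Real.volume_real_Ioo_of_le h₁.le, Real.volume_real_Ioo_of_le h₂.le]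
  exact mul_ne_zero (sub_pos.2 h₁).ne' (sub_pos.2 h₂).ne'

theorem exists_isNeumannPotential (h₁ : a₁ < b₁) (h₂ : a₂ < b₂) {r : ℝ × ℝ → ℝ}
    (hr : MemL2Zero (rectangle a₁ b₁ a₂ b₂) r) :
    ∃ φ, IsNeumannPotential (rectangle a₁ b₁ a₂ b₂) r φ := by
  obtain ⟨C, hP⟩ := zeroMeanH1_poincare h₁ h₂
  obtain ⟨p, hp, hsol⟩ := exists_zeroMeanH1_solution hP (hr.1.toLp r)
  have hp' := hp
  rw [← tripleMk_toLp_coeFn p, tripleMk_mem_zeroMeanH1] at hp'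
  refine ⟨p 0, hp'.2, p 1, p 2, hp'.1, fun v k₁ k₂ hv => ?_⟩
  -- Subtracting `c` from `v` leaves its gradient unchanged, and leaves `∫ r v` unchanged because `∫
  -- r = 0`.
  obtain ⟨c, hvc, hv0⟩ := hv.exists_sub_const (volume_real_rectangle_ne_zero h₁ h₂)
  have key := hsol _ ((tripleMk_mem_zeroMeanH1 hvc.memLp hv.memLp_fst hv.memLp_snd).2 ⟨hvc, hv0⟩)
  have e : ∀ i, p i = (Lp.memLp (p i)).toLp (p i) := fun i => (Lp.toLp_coeFn _ _).symm
  simp only [tripleMk, Matrix.cons_val] at key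
  rw [e 1, e 2, inner_toLp, inner_toLp, inner_toLp] at key
  rw [integral_add (hp'.1.memLp_fst.integrable_fun_mul hv.memLp_fst)
    (hp'.1.memLp_snd.integrable_fun_mul hv.memLp_snd), key]
  simp_rw [mul_sub]
  rw [integral_sub (hr.1.integrable_fun_mul hv.memLp) ((hr.1.integrable one_le_two).mul_const c),
    integral_mul_const, hr.2, zero_mul, sub_zero]

theorem _root_.MeasureTheory.MemLp.toLp_eq_zero_iff {α : Type*} [MeasurableSpace α]
    {μ : Measure α} {f : α → ℝ} (hf : MemLp f 2 μ) : hf.toLp f = 0 ↔ f =ᵐ[μ] 0 := by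
  rw [Lp.eq_zero_iff_ae_eq_zero]
  exact ⟨hf.coeFn_toLp.symm.trans, hf.coeFn_toLp.trans⟩

theorem ae_eq_zero_of_integral_sq_add_sq_eq_zero {α : Type*} [MeasurableSpace α] {μ : Measure α}
    {f g : α → ℝ} (hf : MemLp f 2 μ) (hg : MemLp g 2 μ)
    (h : ∫ x, (f x * f x + g x * g x) ∂μ = 0) : f =ᵐ[μ] 0 ∧ g =ᵐ[μ] 0 := by
  rw [integral_eq_zero_iff_of_nonneg
    (fun x => add_nonneg (mul_self_nonneg _) (mul_self_nonneg _))
    ((hf.integrable_fun_mul hf).add (hg.integrable_fun_mul hg))] at h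
  constructor <;> filter_upwards [h] with x hx <;>
  · have : f x * f x + g x * g x = 0 := hx
    simp only [Pi.zero_apply]
    nlinarith [mul_self_nonneg (f x), mul_self_nonneg (g x)]

/-- Both equations tested with `ψ - φ` show that the gradient of the difference vanishes. Poincaré
then kills the difference itself. -/
theorem IsNeumannPotential.ae_eq (h₁ : a₁ < b₁) (h₂ : a₂ < b₂) {r φ ψ : ℝ × ℝ → ℝ}
    (hφ : IsNeumannPotential (rectangle a₁ b₁ a₂ b₂) r φ)
    (hψ : IsNeumannPotential (rectangle a₁ b₁ a₂ b₂) r ψ) :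
    ψ =ᵐ[volume.restrict (rectangle a₁ b₁ a₂ b₂)] φ := by
  obtain ⟨C, hP⟩ := exists_poincare_const h₁ h₂
  obtain ⟨i0, g₁, g₂, hg, sg⟩ := hφ
  obtain ⟨j0, k₁, k₂, hk, sk⟩ := hψ
  have hd := hk.sub hg
  have key : ∫ x in rectangle a₁ b₁ a₂ b₂, ((k₁ x - g₁ x) * (k₁ x - g₁ x) +
      (k₂ x - g₂ x) * (k₂ x - g₂ x)) = 0 := by
    have e := sub_eq_zero.2 ((sk _ _ _ hd).trans (sg _ _ _ hd).symm)
    have ik : Integrable (fun x => k₁ x * (k₁ x - g₁ x) + k₂ x * (k₂ x - g₂ x))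
        (volume.restrict (rectangle a₁ b₁ a₂ b₂)) :=
      (hk.memLp_fst.integrable_fun_mul hd.memLp_fst).add
        (hk.memLp_snd.integrable_fun_mul hd.memLp_snd)
    have ig : Integrable (fun x => g₁ x * (k₁ x - g₁ x) + g₂ x * (k₂ x - g₂ x))
        (volume.restrict (rectangle a₁ b₁ a₂ b₂)) :=
      (hg.memLp_fst.integrable_fun_mul hd.memLp_fst).add
        (hg.memLp_snd.integrable_fun_mul hd.memLp_snd)
    rw [← e, ← integral_sub ik ig]
    congr 1
    ext x
    ring
  obtain ⟨z1, z2⟩ := ae_eq_zero_of_integral_sq_add_sq_eq_zero hd.memLp_fst hd.memLp_snd key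
  have := hP _ _ _ hd (by
    rw [integral_sub (hk.memLp.integrable one_le_two) (hg.memLp.integrable one_le_two), i0, j0,
      sub_zero])
  have n1 : hd.memLp_fst.toLp _ = 0 := (hd.memLp_fst.toLp_eq_zero_iff).2 z1
  have n2 : hd.memLp_snd.toLp _ = 0 := (hd.memLp_snd.toLp_eq_zero_iff).2 z2
  rw [n1, n2, norm_zero, add_zero, mul_zero, norm_le_zero_iff, MemLp.toLp_eq_zero_iff] at this
  filter_upwards [this] with x hx
  exact sub_eq_zero.1 hx

theorem isNeumannPotential_neumannPotential (h₁ : a₁ < b₁) (h₂ : a₂ < b₂) {r : ℝ × ℝ → ℝ}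
    (hr : MemL2Zero (rectangle a₁ b₁ a₂ b₂) r) :
    IsNeumannPotential (rectangle a₁ b₁ a₂ b₂) r
      (neumannPotential (rectangle a₁ b₁ a₂ b₂) r) :=
  Classical.epsilon_spec (exists_isNeumannPotential h₁ h₂ hr)

/-- Testing the equation with the potential itself turns the energy into half the squared norm of
its gradient. -/
theorem poissonEnergy_nonneg (h₁ : a₁ < b₁) (h₂ : a₂ < b₂) {r : ℝ × ℝ → ℝ}
    (hr : MemL2Zero (rectangle a₁ b₁ a₂ b₂) r) :
    0 ≤ poissonEnergy (rectangle a₁ b₁ a₂ b₂) r := by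
  obtain ⟨-, g₁, g₂, hg, s⟩ := isNeumannPotential_neumannPotential h₁ h₂ hr
  rw [poissonEnergy, ← s _ _ _ hg]
  exact mul_nonneg (by norm_num)
    (integral_nonneg fun x => add_nonneg (mul_self_nonneg _) (mul_self_nonneg _))

theorem integral_sq_eq_zero_iff_poissonEnergy_eq_zero (h₁ : a₁ < b₁) (h₂ : a₂ < b₂)
    {r : ℝ × ℝ → ℝ} (hr : MemL2Zero (rectangle a₁ b₁ a₂ b₂) r) :
    ∫ x in rectangle a₁ b₁ a₂ b₂, r x ^ 2 = 0 ↔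
      poissonEnergy (rectangle a₁ b₁ a₂ b₂) r = 0 := by
  constructor
  · intro h
    rw [integral_eq_zero_iff_of_nonneg (fun x => sq_nonneg _) hr.1.integrable_sq] at h
    rw [poissonEnergy, integral_eq_zero_of_ae, mul_zero]
    filter_upwards [h] with x hx
    rw [pow_eq_zero_iff two_ne_zero |>.1 hx, zero_mul, Pi.zero_apply]
  · intro h
    obtain ⟨-, g₁, g₂, hg, s⟩ := isNeumannPotential_neumannPotential h₁ h₂ hr
    rw [poissonEnergy, ← s _ _ _ hg, mul_eq_zero, or_iff_right (by norm_num)] at h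
    obtain ⟨z1, z2⟩ := ae_eq_zero_of_integral_sq_add_sq_eq_zero hg.memLp_fst hg.memLp_snd h
    -- With zero gradient, the weak equation reads `∫ r f = 0` for every test function `f`.
    have := ae_eq_zero_of_integral_test_eq_zero isOpen_rectangle volume_rectangle_ne_top hr.1
      fun f hf => by
        rw [← s _ _ _ hf.hasH1Gradient]
        refine integral_eq_zero_of_ae ?_
        filter_upwards [z1, z2] with x hx1 hx2
        simp [hx1, hx2]
    refine integral_eq_zero_of_ae ?_
    filter_upwards [this] with x hx
    simp [hx]

end

end PoissonFloorplan

theorem mainTheorem10 (a₁ b₁ a₂ b₂ : ℝ) (h₁ : a₁ < b₁) (h₂ : a₂ < b₂) :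
    (∀ r : ℝ × ℝ → ℝ,
      PoissonFloorplan.MemL2Zero (PoissonFloorplan.rectangle a₁ b₁ a₂ b₂) r →
        (∃ φ, PoissonFloorplan.IsNeumannPotential
            (PoissonFloorplan.rectangle a₁ b₁ a₂ b₂) r φ ∧
          ∀ ψ, PoissonFloorplan.IsNeumannPotential
            (PoissonFloorplan.rectangle a₁ b₁ a₂ b₂) r ψ →
            ψ =ᵐ[volume.restrict (PoissonFloorplan.rectangle a₁ b₁ a₂ b₂)] φ) ∧
        0 ≤ PoissonFloorplan.poissonEnergy (PoissonFloorplan.rectangle a₁ b₁ a₂ b₂) r ∧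
        (∫ x in PoissonFloorplan.rectangle a₁ b₁ a₂ b₂, r x ^ 2 = 0 ↔
          PoissonFloorplan.poissonEnergy (PoissonFloorplan.rectangle a₁ b₁ a₂ b₂) r = 0)) ∧
    (∀ (n : ℕ) (K : Fin n → Set (ℝ × ℝ)) (c : Fin n → ℝ × ℝ),
      (∀ i, MeasurableSet (K i)) → (∀ i, volume (K i) ≠ ⊤) →
      PoissonFloorplan.MemL2Zero (PoissonFloorplan.rectangle a₁ b₁ a₂ b₂)
        (PoissonFloorplan.residual (PoissonFloorplan.rectangle a₁ b₁ a₂ b₂) K c) →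
        0 ≤ PoissonFloorplan.floorplanEnergy
          (PoissonFloorplan.rectangle a₁ b₁ a₂ b₂) K c ∧
        (PoissonFloorplan.densityVariance
            (PoissonFloorplan.rectangle a₁ b₁ a₂ b₂) K c = 0 ↔
          PoissonFloorplan.floorplanEnergy
            (PoissonFloorplan.rectangle a₁ b₁ a₂ b₂) K c = 0)) := by
  refine ⟨fun r hr => ?_, fun n K c _ _ hr => ?_⟩
  · obtain ⟨φ, hφ⟩ := PoissonFloorplan.exists_isNeumannPotential h₁ h₂ hr
    exact ⟨⟨φ, hφ, fun ψ hψ => hφ.ae_eq h₁ h₂ hψ⟩,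
      PoissonFloorplan.poissonEnergy_nonneg h₁ h₂ hr,
      PoissonFloorplan.integral_sq_eq_zero_iff_poissonEnergy_eq_zero h₁ h₂ hr⟩
  -- By definition the variance is the integral of the squared residual and the floorplan energy is
  -- its Poisson energy.
  · exact ⟨PoissonFloorplan.poissonEnergy_nonneg h₁ h₂ hr,
      PoissonFloorplan.integral_sq_eq_zero_iff_poissonEnergy_eq_zero h₁ h₂ hr⟩
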